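/- For permutations $\tau\in\mathfrak S_k$ and $\pi\in\mathfrak S_n$, an occurrence of $\tau$ in $\pi$ is a choice of positions $i_1<\dots<i_k$ such that $(\pi_{i_1},\dots,\pi_{i_k})$ is order-isomorphic to $\tau$; let $\sharp\tau(\pi)$ be the number of occurrences, and say that $\pi$ avoids $\tau$ if $\sharp\tau(\pi)=0$. Let $\mathcal S(132)$ be the set of all $132$-avoiding permutations of all sizes $n\ge 0$ (including the empty permutation), and $\mathcal I(132)$ the set of those $\pi\in\mathcal S(132)$ that are involutions, $\pi=\pi^{-1}$. In the ring $\mathbb Z[[x_1,x_2,\dots]]$ of formal power series define $$C_I(x_1,x_2,\dots)=\sum_{\pi\in\mathcal I(132)}\ \prod_{k\ge 1}x_k^{\sharp 12\cdots k(\pi)},\qquad C_S(x_1,x_2,\dots)=\sum_{\pi\in\mathcal S(132)}\ \prod_{k\ge 1}x_k^{\sharp 12\cdots k(\pi)}.$$ Theorem. The following identities hold in $\mathbb Z[[x_1,x_2,\dots]]$, and the denominators in them are invertible there: $$C_I(x_1,x_2,\dots)=\frac{1+x_1\,C_I(x_1x_2,\,x_2x_3,\dots)}{1-x_1^2\,C_S(x_1^2x_2^2,\,x_2^2x_3^2,\dots)},\qquad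 C_S(x_1,x_2,\dots)=\frac{1}{1-x_1\,C_S(x_1x_2,\,x_2x_3,\dots)}.$$ -/

import Mathlib

open MvPowerSeries

/-- An occurrence of the pattern `τ ∈ 𝔖_k` in `π ∈ 𝔖_n`: a choice of positions
`f 0 < f 1 < ⋯ < f (k - 1)` such that the subsequence of `π` at these positions is
order-isomorphic to `τ`. -/
def IsOccurrence {k n : ℕ} (τ : Equiv.Perm (Fin k)) (π : Equiv.Perm (Fin n))
    (f : Fin k ↪o Fin n) : Prop :=
  ∀ i j : Fin k, π (f i) < π (f j) ↔ τ i < τ j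

/-- The number of occurrences of the classical pattern `τ` in `π`. -/
noncomputable def numOccurrences {k n : ℕ} (τ : Equiv.Perm (Fin k))
    (π : Equiv.Perm (Fin n)) : ℕ :=
  Nat.card {f : Fin k ↪o Fin n // IsOccurrence τ π f}

/-- `π` avoids the pattern `τ`. -/
def AvoidsPattern {k n : ℕ} (τ : Equiv.Perm (Fin k)) (π : Equiv.Perm (Fin n)) : Prop :=
  ¬ ∃ f : Fin k ↪o Fin n, IsOccurrence τ π f

/-- The pattern `1-3-2`, as a permutation of `{0, 1, 2}`. -/
def pattern132 : Equiv.Perm (Fin 3) := Equiv.swap 1 2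

/-- The pattern `1-2-⋯-k`. -/
def increasingPattern (k : ℕ) : Equiv.Perm (Fin k) := 1

/-- All permutations of all sizes `n ≥ 0`, including the empty permutation. -/
abbrev AnyPerm : Type := Σ n : ℕ, Equiv.Perm (Fin n)

/-- The `1-3-2`-avoiding permutations of all sizes. -/
def perms132 : Set AnyPerm := {π | AvoidsPattern pattern132 π.2}

/-- The `1-3-2`-avoiding involutions of all sizes. -/
def involutions132 : Set AnyPerm := {π | π.2 = π.2⁻¹ ∧ AvoidsPattern pattern132 π.2}

/-- A permutation of `n` letters has no occurrence of a pattern with more than `n` letters. -/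
theorem numOccurrences_eq_zero_of_lt {k n : ℕ} (τ : Equiv.Perm (Fin k))
    (π : Equiv.Perm (Fin n)) (h : n < k) : numOccurrences τ π = 0 := by
  have : IsEmpty {f : Fin k ↪o Fin n // IsOccurrence τ π f} :=
    ⟨fun f => absurd (Fintype.card_le_of_injective f.1 f.1.injective) (by simpa using h)⟩
  exact Nat.card_of_isEmpty

/-- The exponent vector of the monomial `∏_{k ≥ 1} x_k ^ (♯ 1-2-⋯-k (π))`. -/
noncomputable def patternExponent (π : AnyPerm) : ℕ+ →₀ ℕ :=
  Finsupp.onFinset (Finset.Icc 1 π.1.succPNat)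
    (fun k : ℕ+ => numOccurrences (increasingPattern k) π.2) (by
      intro k hk
      by_contra hc
      refine hk (numOccurrences_eq_zero_of_lt _ _ ?_)
      simp only [Finset.mem_Icc, one_le, true_and, not_le] at hc
      have h : π.1.succPNat.val < k.val := hc
      rw [Nat.succPNat_coe] at h
      omega)

/-- The formal sum `∑_{π ∈ A} ∏_{k ≥ 1} x_k ^ (♯ 1-2-⋯-k (π))`: the coefficient of a monomial
is the number of `π ∈ A` contributing that monomial. -/
noncomputable def patternGF (A : Set AnyPerm) : MvPowerSeries ℕ+ ℤ :=
  fun d => (Set.ncard {π ∈ A | patternExponent π = d} : ℤ)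

/-- `C_I(x₁, x₂, …)`. -/
noncomputable def CI : MvPowerSeries ℕ+ ℤ := patternGF involutions132

/-- `C_S(x₁, x₂, …)`. -/
noncomputable def CS : MvPowerSeries ℕ+ ℤ := patternGF perms132

/-- The exponent of `x₁` is the number of letters. -/
theorem patternExponent_one (π : AnyPerm) : patternExponent π 1 = π.1 := by
  obtain ⟨n, π⟩ := π
  change Nat.card {f : Fin 1 ↪o Fin n // IsOccurrence (increasingPattern 1) π f} = n
  have e : {f : Fin 1 ↪o Fin n // IsOccurrence (increasingPattern 1) π f} ≃ Fin n :=
    { toFun := fun f => f.1 0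
      invFun := fun a => ⟨OrderEmbedding.ofStrictMono (fun _ => a)
        (fun i j h => absurd (Subsingleton.elim i j) h.ne), fun i j => by
          simp [Subsingleton.elim i j]⟩
      left_inv := fun f => by
        ext i
        rw [Subsingleton.elim i 0]
        rfl
      right_inv := fun a => rfl }
  rw [Nat.card_congr e, Nat.card_fin]

/-- Each monomial comes from finitely many permutations, so that the cardinalities in
`patternGF` are genuine. -/
theorem finite_patternExponent_eq (A : Set AnyPerm) (d : ℕ+ →₀ ℕ) :
    {π ∈ A | patternExponent π = d}.Finite := by
  refine Set.Finite.subset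
    (Set.finite_range (fun p : Equiv.Perm (Fin (d 1)) => (⟨d 1, p⟩ : AnyPerm))) ?_
  rintro ⟨n, p⟩ ⟨-, h⟩
  obtain rfl : n = d 1 := by rw [← h, patternExponent_one]
  exact ⟨p, rfl⟩

/-- The family `(x_k x_{k+1})_{k ≥ 1}` may be substituted into a formal power series in
`x₁, x₂, …`. -/
theorem hasSubst_shift :
    HasSubst (fun k : ℕ+ => (X k * X (k + 1) : MvPowerSeries ℕ+ ℤ)) :=
  HasSubst.mul_right _ HasSubst.X

/-- The family `(x_k² x_{k+1}²)_{k ≥ 1}` may be substituted into a formal power series in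
`x₁, x₂, …`. -/
theorem hasSubst_shift_sq :
    HasSubst (fun k : ℕ+ => (X k ^ 2 * X (k + 1) ^ 2 : MvPowerSeries ℕ+ ℤ)) :=
  HasSubst.mul_right _ (HasSubst.X_pow two_ne_zero)

/-! Cut a nonempty `132`-avoider at its largest letter. Every letter to its left exceeds every
letter to its right, since otherwise the two form a `132` with the maximum. So it is uniquely `(σ ⊕
1) ⊖ τ` with `σ`, `τ` avoiding `132` (`Avoids132.exists_eq_skew`, `skew_snoc_inj`). Inversion
reverses the blocks of a skew sum. Hence for an involution either `τ` is empty and `σ` is an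
involution, or `τ = ρ ⊖ (σ⁻¹ ⊕ 1)` with `ρ` an involution (`exists_eq_skew_of_inv_eq`).

Increasing subsequences cannot cross a skew sum, so exponents add there (`inc_skew`). In `σ ⊕ 1` the
last letter may be appended to any increasing subsequence of `σ`, which amounts to `x_k ↦ x_k
x_{k+1}` and a factor `x₁` (`patternExponent_snoc`). As `σ` and `σ⁻¹` have equal weight (`inc_inv`),
the paired blocks contribute squares. The bijections thus become `CS_eq` and `CI_eq`, and solving
these linear relations gives the quotients. -/

/-! ### Generating functions of weighted families -/

/-- The generating function of a family of exponent vectors. -/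
noncomputable def weightGF {T : Type} (w : T → ℕ+ →₀ ℕ) : MvPowerSeries ℕ+ ℤ :=
  fun d => (Nat.card {t // w t = d} : ℤ)

theorem coeff_weightGF {T : Type} (w : T → ℕ+ →₀ ℕ) (d : ℕ+ →₀ ℕ) :
    coeff d (weightGF w) = (Nat.card {t // w t = d} : ℤ) := rfl

theorem patternGF_eq_weightGF (A : Set AnyPerm) :
    patternGF A = weightGF (fun π : A => patternExponent π) := by
  funext d
  have e : {π ∈ A | patternExponent π = d} ≃ {t : A // patternExponent t = d} :=
    (Equiv.subtypeSubtypeEquivSubtypeInter (· ∈ A) (fun π => patternExponent π = d)).symm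
  exact congrArg Nat.cast (Nat.card_congr e)

theorem finite_patternExponent_fiber (A : Set AnyPerm) (d : ℕ+ →₀ ℕ) :
    Finite {t : A // patternExponent t = d} := by
  have : Finite {π // π ∈ A ∧ patternExponent π = d} := (finite_patternExponent_eq A d).to_subtype
  exact Finite.of_equiv _
    (Equiv.subtypeSubtypeEquivSubtypeInter (· ∈ A) (fun π => patternExponent π = d)).symm

theorem weightGF_congr {T T' : Type} {w : T → ℕ+ →₀ ℕ} {w' : T' → ℕ+ →₀ ℕ} (e : T ≃ T')
    (h : ∀ t, w' (e t) = w t) : weightGF w = weightGF w' := by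
  funext d
  exact congrArg Nat.cast (Nat.card_congr (e.subtypeEquiv fun t => by rw [h]))

theorem weightGF_unit (e : ℕ+ →₀ ℕ) : weightGF (fun _ : Unit => e) = monomial e (1 : ℤ) := by
  classical
  ext d
  rw [coeff_weightGF, coeff_monomial]
  split_ifs with h
  · subst h
    simp
  · have : IsEmpty {t : Unit // e = d} := ⟨fun t => h t.2.symm⟩
    simp

theorem weightGF_sum {T T' : Type} {w : T → ℕ+ →₀ ℕ} {w' : T' → ℕ+ →₀ ℕ}
    (hw : ∀ d, Finite {t // w t = d}) (hw' : ∀ d, Finite {t // w' t = d}) :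
    weightGF (Sum.elim w w') = weightGF w + weightGF w' := by
  ext d
  have : Finite {t // Sum.elim w w' (Sum.inl t) = d} := hw d
  have : Finite {t // Sum.elim w w' (Sum.inr t) = d} := hw' d
  rw [map_add, coeff_weightGF, coeff_weightGF, coeff_weightGF,
    Nat.card_congr (Equiv.subtypeSum (p := fun t => Sum.elim w w' t = d))]
  rw [Nat.card_sum, Nat.cast_add]
  rfl

/-- Finite fibres are essential: `Nat.card` is `0` on an infinite type, which would break the count
over the antidiagonal. -/
theorem weightGF_prod {T T' : Type} {w : T → ℕ+ →₀ ℕ} {w' : T' → ℕ+ →₀ ℕ}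
    (hw : ∀ d, Finite {t // w t = d}) (hw' : ∀ d, Finite {t // w' t = d}) :
    weightGF (fun p : T × T' => w p.1 + w' p.2) = weightGF w * weightGF w' := by
  classical
  ext d
  rw [coeff_mul]
  simp only [coeff_weightGF]
  have e : {p : T × T' // w p.1 + w' p.2 = d} ≃
      Σ x : Finset.HasAntidiagonal.antidiagonal d, {t // w t = x.1.1} × {t // w' t = x.1.2} :=
    { toFun := fun p => ⟨⟨(w p.1.1, w' p.1.2), by simpa using p.2⟩, ⟨p.1.1, rfl⟩, ⟨p.1.2, rfl⟩⟩
      invFun := fun x => ⟨(x.2.1.1, x.2.2.1), by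
        rw [x.2.1.2, x.2.2.2]; exact Finset.HasAntidiagonal.mem_antidiagonal.mp x.1.2⟩
      left_inv := fun p => rfl
      right_inv := by
        rintro ⟨⟨⟨a, b⟩, h⟩, ⟨t, ht⟩, ⟨t', ht'⟩⟩
        obtain rfl : w t = a := ht
        obtain rfl : w' t' = b := ht'
        rfl }
  have := fun d => Fintype.ofFinite {t // w t = d}
  have := fun d => Fintype.ofFinite {t // w' t = d}
  rw [Nat.card_congr e, Nat.card_sigma, Nat.cast_sum]
  simp only [Nat.card_prod, Nat.cast_mul]
  exact Finset.sum_coe_sort _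
    (fun x : (ℕ+ →₀ ℕ) × (ℕ+ →₀ ℕ) => (Nat.card {t // w t = x.1} : ℤ) *
      (Nat.card {t // w' t = x.2} : ℤ))

theorem finite_fiber_of_le {T : Type} {w : T → ℕ+ →₀ ℕ} (hw : ∀ d, Finite {t // w t = d})
    {w' : T → ℕ+ →₀ ℕ} (h : ∀ t, w t ≤ w' t) (d : ℕ+ →₀ ℕ) : Finite {t // w' t = d} := by
  have : Set.Finite (⋃ e ∈ Set.Iic d, {t | w t = e}) :=
    (Set.finite_Iic d).biUnion fun e _ => hw e
  refine (this.subset ?_).to_subtype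
  rintro t rfl
  simpa using h t

theorem finite_fiber_prod {T T' : Type} {w : T → ℕ+ →₀ ℕ} {w' : T' → ℕ+ →₀ ℕ}
    (hw : ∀ d, Finite {t // w t = d}) (hw' : ∀ d, Finite {t // w' t = d}) (d : ℕ+ →₀ ℕ) :
    Finite {p : T × T' // w p.1 + w' p.2 = d} := by
  have h1 : Set.Finite (⋃ e ∈ Set.Iic d, {t | w t = e}) :=
    (Set.finite_Iic d).biUnion fun e _ => hw e
  have h2 : Set.Finite (⋃ e ∈ Set.Iic d, {t | w' t = e}) :=
    (Set.finite_Iic d).biUnion fun e _ => hw' e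
  refine ((h1.prod h2).subset ?_).to_subtype
  rintro ⟨t, t'⟩ rfl
  simp

/-- Substituting monomials with exponents `v k` transforms the exponent vectors linearly. -/
theorem weightGF_subst {T : Type} {w : T → ℕ+ →₀ ℕ} (hw : ∀ d, Finite {t // w t = d})
    {a : ℕ+ → MvPowerSeries ℕ+ ℤ} (ha : HasSubst a) (L : (ℕ+ →₀ ℕ) →+ (ℕ+ →₀ ℕ))
    (hL : ∀ d, d ≤ L d) (haL : ∀ k, a k = monomial (L (Finsupp.single k 1)) 1) :
    subst a (weightGF w) = weightGF (fun t => L (w t)) := by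
  classical
  ext d
  have hprod : ∀ c : ℕ+ →₀ ℕ, (c.prod fun s e => a s ^ e) = monomial (L c) (1 : ℤ) := by
    intro c
    induction c using Finsupp.induction_linear with
    | zero => rw [Finsupp.prod_zero_index, map_zero, monomial_zero_one]
    | add f g hf hg =>
      rw [Finsupp.prod_add_index' (by simp) (by simp [pow_add]), hf, hg, monomial_mul_monomial,
        map_add, one_mul]
    | single k n =>
      rw [Finsupp.prod_single_index (by simp), haL, monomial_pow, one_pow, ← map_nsmul]
      simp
  -- Only exponents `c` with `L c = d` contribute, and `c ≤ L c` confines them to the finite set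
  -- `Iic d`.
  rw [coeff_subst ha, finsum_eq_sum_of_support_subset (s := (Finset.Iic d).filter (L · = d))]
  · have e : {t // L (w t) = d} ≃
        Σ x : (Finset.Iic d).filter (L · = d), {t // w t = x.1} :=
      { toFun := fun t => ⟨⟨w t.1, by
          simpa using ⟨(hL _).trans t.2.le, t.2⟩⟩, ⟨t.1, rfl⟩⟩
        invFun := fun x => ⟨x.2.1, by rw [x.2.2]; exact (Finset.mem_filter.mp x.1.2).2⟩
        left_inv := fun p => rfl
        right_inv := by
          rintro ⟨⟨a, h⟩, ⟨t, ht⟩⟩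
          obtain rfl : w t = a := ht
          rfl }
    have := fun d => Fintype.ofFinite {t // w t = d}
    rw [coeff_weightGF, Nat.card_congr e, Nat.card_sigma, Nat.cast_sum,
      Finset.sum_coe_sort _ (fun x => (Nat.card {t // w t = x} : ℤ))]
    refine Finset.sum_congr rfl fun c hc => ?_
    rw [hprod, coeff_monomial, if_pos (Finset.mem_filter.mp hc).2.symm, coeff_weightGF]
    simp
  · intro c hc
    rw [Function.mem_support, hprod, coeff_monomial] at hc
    have : d = L c := by
      by_contra h
      simp [h] at hc
    subst this
    simpa using hL c

/-! ### Permutations as functions on `ℕ`; direct and skew sums -/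

namespace AnyPerm

/-- A permutation as a function on `ℕ`, the identity beyond its size. -/
def ev (π : AnyPerm) (i : ℕ) : ℕ := if h : i < π.1 then π.2 ⟨i, h⟩ else i

theorem ev_of_lt (π : AnyPerm) {i : ℕ} (h : i < π.1) : π.ev i = π.2 ⟨i, h⟩ := dif_pos h

theorem ev_of_le (π : AnyPerm) {i : ℕ} (h : π.1 ≤ i) : π.ev i = i := dif_neg h.not_gt

theorem ev_lt (π : AnyPerm) {i : ℕ} (h : i < π.1) : π.ev i < π.1 := by
  rw [ev_of_lt π h]
  exact Fin.is_lt _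

theorem ext {π ρ : AnyPerm} (h : π.1 = ρ.1) (h' : ∀ i < π.1, π.ev i = ρ.ev i) : π = ρ := by
  obtain ⟨n, π⟩ := π
  obtain ⟨m, ρ⟩ := ρ
  obtain rfl : n = m := h
  congr 1
  ext i
  have := h' i i.2
  rwa [ev_of_lt _ i.2, ev_of_lt _ i.2] at this

/-- The inverse permutation. -/
def inv (π : AnyPerm) : AnyPerm := ⟨π.1, π.2⁻¹⟩

@[simp] theorem inv_fst (π : AnyPerm) : π.inv.1 = π.1 := rfl

@[simp] theorem inv_inv (π : AnyPerm) : π.inv.inv = π := rfl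

@[simp] theorem ev_inv_ev (π : AnyPerm) (i : ℕ) : π.inv.ev (π.ev i) = i := by
  by_cases h : i < π.1
  · have h' : π.ev i < π.inv.1 := π.ev_lt h
    rw [ev_of_lt _ h']
    simp only [ev_of_lt π h]
    exact congrArg Fin.val (π.2.symm_apply_apply ⟨i, h⟩)
  · rw [π.ev_of_le (not_lt.mp h)]
    exact ev_of_le _ (not_lt.mp h)

@[simp] theorem ev_ev_inv (π : AnyPerm) (i : ℕ) : π.ev (π.inv.ev i) = i := π.inv.ev_inv_ev i

theorem ev_injective (π : AnyPerm) : Function.Injective π.ev :=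
  Function.LeftInverse.injective π.ev_inv_ev

theorem eq_inv_of_ev_ev {π ρ : AnyPerm} (h : π.1 = ρ.1)
    (h' : ∀ i < ρ.1, π.ev (ρ.ev i) = i) : π = ρ.inv := by
  refine ext h fun i hi => ?_
  have := h' (ρ.inv.ev i) (by simpa using ρ.inv.ev_lt (h ▸ hi))
  simpa using this

/-- The permutation of `n` letters given by an injective self-map of `{0, …, n - 1}`. -/
noncomputable def ofInj (n : ℕ) (f : ℕ → ℕ) (hlt : ∀ i < n, f i < n)
    (hinj : ∀ i < n, ∀ j < n, f i = f j → i = j) : AnyPerm :=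
  ⟨n, Equiv.ofBijective (fun i : Fin n => (⟨f i, hlt i i.2⟩ : Fin n))
    (Finite.injective_iff_bijective.mp fun i j h =>
      Fin.ext (hinj i i.2 j j.2 (congrArg Fin.val h)))⟩

theorem ev_ofInj {n : ℕ} {f : ℕ → ℕ} (hlt : ∀ i < n, f i < n)
    (hinj : ∀ i < n, ∀ j < n, f i = f j → i = j) {i : ℕ} (hi : i < n) :
    (ofInj n f hlt hinj).ev i = f i :=
  ev_of_lt (ofInj n f hlt hinj) hi

/-- The empty permutation. -/
def empty : AnyPerm := ⟨0, 1⟩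

@[simp] theorem empty_fst : empty.1 = 0 := rfl

theorem eq_empty {π : AnyPerm} (h : π.1 = 0) : π = empty :=
  ext h fun i hi => absurd hi (by omega)

/-- The direct sum `σ ⊕ 1`: append a new largest letter. -/
noncomputable def snoc (σ : AnyPerm) : AnyPerm :=
  ofInj (σ.1 + 1) σ.ev (fun i hi => by
    rcases (Nat.lt_succ_iff_lt_or_eq.mp hi) with h | rfl
    · exact (σ.ev_lt h).trans (Nat.lt_succ_self _)
    · rw [σ.ev_of_le le_rfl]; exact hi) (fun _ _ _ _ h => σ.ev_injective h)

@[simp] theorem snoc_fst (σ : AnyPerm) : σ.snoc.1 = σ.1 + 1 := rfl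

-- The new letter is a fixed point at position `σ.1`, which is exactly the default value of `σ.ev`
-- there.
@[simp] theorem ev_snoc (σ : AnyPerm) : σ.snoc.ev = σ.ev := by
  funext i
  by_cases h : i < σ.1 + 1
  · exact ev_ofInj _ _ h
  · rw [ev_of_le _ (by simpa using h), ev_of_le _ (by omega)]

/-- The skew sum: a copy of `π` placed above and to the left of a copy of `ρ`. -/
noncomputable def skew (π ρ : AnyPerm) : AnyPerm :=
  ofInj (π.1 + ρ.1) (fun i => if i < π.1 then π.ev i + ρ.1 else ρ.ev (i - π.1))
    (fun i hi => by
      split_ifs with h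
      · have := π.ev_lt h
        omega
      · have := ρ.ev_lt (i := i - π.1) (by omega)
        omega)
    (fun i hi j hj h => by
      split_ifs at h with h1 h2 h2
      · exact π.ev_injective (by omega)
      · have := ρ.ev_lt (i := j - π.1) (by omega)
        omega
      · have := ρ.ev_lt (i := i - π.1) (by omega)
        omega
      · have := ρ.ev_injective h
        omega)

@[simp] theorem skew_fst (π ρ : AnyPerm) : (skew π ρ).1 = π.1 + ρ.1 := rfl

theorem ev_skew_left (π ρ : AnyPerm) {i : ℕ} (h : i < π.1) :
    (skew π ρ).ev i = π.ev i + ρ.1 := by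
  refine (ev_ofInj _ _ (by omega)).trans ?_
  simp [h]

theorem ev_skew_right (π ρ : AnyPerm) {i : ℕ} (h : i < ρ.1) :
    (skew π ρ).ev (π.1 + i) = ρ.ev i := by
  refine (ev_ofInj _ _ (by omega)).trans ?_
  simp

theorem forall_lt_add {a b : ℕ} {P : ℕ → Prop} (h1 : ∀ i < a, P i) (h2 : ∀ i < b, P (a + i)) :
    ∀ i < a + b, P i := fun i hi => by
  by_cases h : i < a
  · exact h1 i h
  · obtain ⟨j, rfl⟩ := Nat.exists_eq_add_of_le (not_lt.mp h)
    exact h2 j (by omega)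

/-- Reflection in the diagonal exchanges the upper left and lower right corners. -/
theorem inv_skew (π ρ : AnyPerm) : (skew π ρ).inv = skew ρ.inv π.inv := by
  refine (eq_inv_of_ev_ev (by simp [add_comm]) (forall_lt_add (fun i hi => ?_)
    (fun i hi => ?_))).symm
  · have := ev_skew_right ρ.inv π.inv (i := π.ev i) (π.ev_lt hi)
    rw [ev_skew_left _ _ hi, add_comm]
    simpa using this
  · have := ev_skew_left ρ.inv π.inv (i := ρ.ev i) (ρ.ev_lt hi)
    rw [ev_skew_right _ _ hi, this, ev_inv_ev, inv_fst, add_comm]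

theorem inv_snoc (σ : AnyPerm) : σ.snoc.inv = σ.inv.snoc :=
  (eq_inv_of_ev_ev (by simp) fun i _ => by simp).symm

theorem skew_assoc (π ρ κ : AnyPerm) : skew (skew π ρ) κ = skew π (skew ρ κ) := by
  refine ext (by simp [add_assoc]) (forall_lt_add (forall_lt_add (fun i hi => ?_)
    (fun i hi => ?_)) (fun i hi => ?_))
  · rw [ev_skew_left _ _ (by simp; omega), ev_skew_left _ _ hi, ev_skew_left _ _ hi]
    simp; omega
  · rw [ev_skew_left _ _ (by simp; omega), ev_skew_right _ _ hi, ev_skew_right _ _ (by simp; omega),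
      ev_skew_left _ _ hi]
  · rw [ev_skew_right _ _ hi, skew_fst, add_assoc, ev_skew_right _ _ (by simp; omega),
      ev_skew_right _ _ hi]

theorem skew_empty (π : AnyPerm) : skew π empty = π :=
  ext (by simp) fun i hi => by rw [ev_skew_left _ _ (by simpa using hi)]; simp

theorem snoc_injective : Function.Injective snoc := fun σ τ h => by
  have h1 := congrArg Sigma.fst h
  have h2 := congrArg ev h
  simp only [snoc_fst, ev_snoc] at h1 h2
  exact ext (by omega) fun i _ => congrFun h2 i

/-- The largest letter sits at position `σ.1`, so its position recovers the size of `σ`; the blocks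
are then read off. -/
theorem skew_snoc_inj {σ τ σ' τ' : AnyPerm} (h : skew σ.snoc τ = skew σ'.snoc τ') :
    σ = σ' ∧ τ = τ' := by
  have h1 := congrArg Sigma.fst h
  simp only [skew_fst, snoc_fst] at h1
  have e1 : (skew σ.snoc τ).ev σ.1 = σ.1 + τ.1 := by
    rw [ev_skew_left _ _ (by simp), ev_snoc, ev_of_le _ le_rfl]
  have e2 : (skew σ.snoc τ).ev σ'.1 = σ'.1 + τ'.1 := by
    rw [h, ev_skew_left _ _ (by simp), ev_snoc, ev_of_le _ le_rfl]
  have h2 : σ.1 = σ'.1 := (skew σ.snoc τ).ev_injective (by omega)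
  have h3 : τ.1 = τ'.1 := by omega
  constructor
  · refine ext h2 fun i hi => ?_
    have e1 := ev_skew_left σ.snoc τ (i := i) (by simp; omega)
    rw [h, ev_skew_left _ _ (by simp; omega), ev_snoc, ev_snoc] at e1
    omega
  · refine ext h3 fun i hi => ?_
    have e1 := ev_skew_right σ.snoc τ hi
    rw [h, snoc_fst, h2, ← snoc_fst, ev_skew_right _ _ (h3 ▸ hi)] at e1
    exact e1.symm

/-! ### Avoidance of `132` and decomposition at the largest letter -/

/-- `π` avoids `1-3-2`. -/
def Avoids132 (π : AnyPerm) : Prop :=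
  ∀ i j k, i < j → j < k → k < π.1 → π.ev i < π.ev k → π.ev j ≤ π.ev k

theorem avoids132_iff (π : AnyPerm) : AvoidsPattern pattern132 π.2 ↔ Avoids132 π := by
  constructor
  · intro h i j k hij hjk hk hik
    by_contra! hkj
    rw [ev_of_lt _ hk, ev_of_lt _ (by omega)] at hik hkj
    have hik := Fin.lt_def.mpr hik
    have hkj := Fin.lt_def.mpr hkj
    refine h ⟨OrderEmbedding.ofStrictMono
      (![⟨i, by omega⟩, ⟨j, by omega⟩, ⟨k, hk⟩] : Fin 3 → Fin π.1) ?_, ?_⟩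
    · intro x y hxy
      fin_cases x <;> fin_cases y <;> simp at hxy ⊢ <;> omega
    · intro x y
      have h1 := hik.trans hkj
      change π.2 ((![⟨i, by omega⟩, ⟨j, by omega⟩, ⟨k, hk⟩] : Fin 3 → Fin π.1) x) <
        π.2 ((![⟨i, by omega⟩, ⟨j, by omega⟩, ⟨k, hk⟩] : Fin 3 → Fin π.1) y) ↔ _
      fin_cases x <;> fin_cases y <;>
        simp [pattern132, Equiv.swap_apply_def, hik, hkj, h1, hik.le, hkj.le, h1.le]
  · rintro h ⟨f, hf⟩
    have h1 := (hf 0 2).mpr (by decide)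
    have h2 := (hf 2 1).mpr (by decide)
    have := h (f 0) (f 1) (f 2) (f.strictMono (by decide)) (f.strictMono (by decide)) (f 2).2
    rw [ev_of_lt _ (f 0).2, ev_of_lt _ (f 1).2, ev_of_lt _ (f 2).2] at this
    exact absurd (this h1) (not_le.mpr h2)

theorem avoids132_empty : Avoids132 empty := fun _ _ k _ _ hk => absurd hk (by simp)

theorem avoids132_snoc {σ : AnyPerm} : Avoids132 σ.snoc ↔ Avoids132 σ := by
  constructor
  · intro h i j k hij hjk hk
    simpa using h i j k hij hjk (by simp; omega)
  · intro h i j k hij hjk hk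
    simp only [snoc_fst, ev_snoc] at hk ⊢
    rcases Nat.lt_succ_iff_lt_or_eq.mp hk with hk | rfl
    · exact h i j k hij hjk hk
    · intro _
      rw [σ.ev_of_le le_rfl]
      exact (σ.ev_lt hjk).le

/-- A `132` begins with its smallest letter, so it cannot start in the upper left block and end in
the lower right one. -/
theorem avoids132_skew {π ρ : AnyPerm} : Avoids132 (skew π ρ) ↔ Avoids132 π ∧ Avoids132 ρ := by
  constructor
  · intro h
    constructor
    · intro i j k hij hjk hk hik
      have := h i j k hij hjk (by simp; omega)
      rw [ev_skew_left _ _ hk, ev_skew_left _ _ (by omega), ev_skew_left _ _ (by omega)] at this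
      omega
    · intro i j k hij hjk hk
      have := h (π.1 + i) (π.1 + j) (π.1 + k) (by omega) (by omega) (by simp; omega)
      rwa [ev_skew_right _ _ hk, ev_skew_right _ _ (by omega),
        ev_skew_right _ _ (by omega)] at this
  · rintro ⟨h1, h2⟩ i j k hij hjk hk
    simp only [skew_fst] at hk
    by_cases hk1 : k < π.1
    · have := h1 i j k hij hjk hk1
      rw [ev_skew_left _ _ hk1, ev_skew_left _ _ (by omega), ev_skew_left _ _ (by omega)]
      omega
    obtain ⟨k, rfl⟩ := Nat.exists_eq_add_of_le (not_lt.mp hk1)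
    rw [ev_skew_right _ _ (by omega)]
    have hkr := ρ.ev_lt (i := k) (by omega)
    by_cases hi : i < π.1
    · rw [ev_skew_left _ _ hi]
      omega
    obtain ⟨i, rfl⟩ := Nat.exists_eq_add_of_le (not_lt.mp hi)
    obtain ⟨j, rfl⟩ := Nat.exists_eq_add_of_le (show π.1 ≤ j by omega)
    rw [ev_skew_right _ _ (by omega), ev_skew_right _ _ (by omega)]
    exact h2 i j k (by omega) (by omega) (by omega)

/-- The pattern `132` is its own inverse. -/
theorem Avoids132.inv {π : AnyPerm} (h : Avoids132 π) : Avoids132 π.inv := by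
  intro i j k hij hjk hk hik
  by_contra! hkj
  have := h (π.inv.ev i) (π.inv.ev k) (π.inv.ev j) hik hkj (π.inv.ev_lt (by omega))
  simp only [ev_ev_inv] at this
  omega

theorem Avoids132.exists_eq_skew {π : AnyPerm} (h : Avoids132 π) (hπ : 0 < π.1) :
    ∃ σ τ, Avoids132 σ ∧ Avoids132 τ ∧ π = skew σ.snoc τ := by
  obtain ⟨p, hp⟩ : ∃ p, π.ev p = π.1 - 1 := ⟨_, π.ev_ev_inv _⟩
  have hpn : p < π.1 := by
    by_contra hc
    rw [π.ev_of_le (by omega)] at hp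
    omega
  obtain ⟨b, hb⟩ : ∃ b, π.1 = p + 1 + b := Nat.exists_eq_add_of_le hpn
  have hmax : ∀ i < π.1, i ≠ p → π.ev i < p + b := fun i hi hip => by
    have h1 := π.ev_lt hi
    have h2 := π.ev_injective.ne hip
    omega
  have hlt : ∀ i < p, ∀ j, p < j → j < π.1 → π.ev j < π.ev i := fun i hi j hj hjn => by
    have h1 := h i p j hi hj hjn
    have h2 := hmax j hjn (by omega)
    have h3 := π.ev_injective.ne (show i ≠ j by omega)
    omega
  -- The `b` letters after position `p` have distinct values below `π.ev i`.
  have hleft : ∀ i < p, b ≤ π.ev i := fun i hi => by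
    have := Finset.card_le_card_of_injOn (s := Finset.Ioo p π.1) (t := Finset.range (π.ev i)) π.ev
      (fun j hj => by
        have hj := Finset.mem_Ioo.mp hj
        simpa using hlt i hi j hj.1 hj.2) π.ev_injective.injOn
    simp at this
    omega
  -- The `p` letters before the maximum have distinct values strictly between `π.ev j` and `p + b`.
  have hright : ∀ j, p < j → j < π.1 → π.ev j < b := fun j hj hjn => by
    have := Finset.card_le_card_of_injOn (s := Finset.range p)
      (t := Finset.Ioo (π.ev j) (p + b)) π.ev
      (fun i hi => by
        have hi := Finset.mem_range.mp hi
        simpa using ⟨hlt i hi j hj hjn, hmax i (by omega) (by omega)⟩) π.ev_injective.injOn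
    have h2 := hmax j hjn (by omega)
    simp at this
    omega
  let σ := ofInj p (fun i => π.ev i - b)
    (fun i hi => by
      have := hmax i (by omega) (by omega)
      have := hleft i hi
      omega)
    (fun i hi j hj hij => by
      have := hleft i hi
      have := hleft j hj
      exact π.ev_injective (by omega))
  let τ := ofInj b (fun i => π.ev (p + 1 + i)) (fun i hi => hright _ (by omega) (by omega))
    (fun i hi j hj hij => by
      have := π.ev_injective hij
      omega)
  have hσ : σ.1 = p := rfl
  have hτ : τ.1 = b := rfl
  have key : skew σ.snoc τ = π := by
    refine ext hb.symm (forall_lt_add (forall_lt_add (fun i hi => ?_) (fun i hi => ?_))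
      (fun i hi => ?_))
    · rw [ev_skew_left _ _ (by simp; omega), ev_snoc, show σ.ev i = _ from ev_ofInj _ _ hi, hτ]
      have := hleft i hi
      omega
    · obtain rfl : i = 0 := by omega
      rw [ev_skew_left _ _ (by simp), ev_snoc, ev_of_le _ (by simp), hτ, hσ, add_zero, hp]
      omega
    · rw [ev_skew_right _ _ hi, show τ.ev i = _ from ev_ofInj _ _ hi, snoc_fst, hσ]
  rw [← key, avoids132_skew, avoids132_snoc] at h
  exact ⟨σ, τ, h.1, h.2, key.symm⟩

theorem exists_eq_skew_of_inv_eq {π : AnyPerm} (h : Avoids132 π) (hi : π.inv = π)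
    (hπ : 0 < π.1) :
    (∃ ρ, Avoids132 ρ ∧ ρ.inv = ρ ∧ π = ρ.snoc) ∨
    ∃ σ ρ, Avoids132 σ ∧ Avoids132 ρ ∧ ρ.inv = ρ ∧ π = skew σ.snoc (skew ρ σ.inv.snoc) := by
  obtain ⟨σ, τ, hσ, hτ, rfl⟩ := h.exists_eq_skew hπ
  rcases Nat.eq_zero_or_pos τ.1 with h0 | h0
  · left
    obtain rfl := eq_empty h0
    rw [skew_empty, inv_snoc] at hi
    exact ⟨σ, hσ, snoc_injective hi, skew_empty _⟩
  · right
    -- Cutting `τ⁻¹` at its maximum exhibits `π⁻¹` in the form `(σ' ⊕ 1) ⊖ …`; uniqueness against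
    -- `π` gives `σ' = σ` and determines `τ`.
    obtain ⟨σ', ρ, -, hρ, hτ'⟩ := hτ.inv.exists_eq_skew h0
    rw [inv_skew, hτ', skew_assoc, inv_snoc] at hi
    obtain ⟨rfl, rfl⟩ := skew_snoc_inj hi
    -- Inverting this `τ` gives a second cut of `τ⁻¹`, with `ρ⁻¹` in the place of `ρ`.
    rw [inv_skew, inv_snoc, inv_inv] at hτ'
    exact ⟨σ', ρ, hσ, hρ, (skew_snoc_inj hτ').2, rfl⟩

theorem skew_snoc_skew_inj {σ ρ σ' ρ' : AnyPerm}
    (h : skew σ.snoc (skew ρ σ.inv.snoc) = skew σ'.snoc (skew ρ' σ'.inv.snoc)) :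
    σ = σ' ∧ ρ = ρ' := by
  obtain ⟨rfl, h⟩ := skew_snoc_inj h
  have h := congrArg inv h
  rw [inv_skew, inv_skew, inv_snoc, inv_inv] at h
  exact ⟨rfl, congrArg inv (skew_snoc_inj h).2⟩

/-- By uniqueness of the cut, the part after the maximum would have to be empty. -/
theorem snoc_ne_skew_snoc_skew {κ σ ρ π : AnyPerm} :
    κ.snoc ≠ skew σ.snoc (skew ρ π.snoc) := fun h => by
  rw [← skew_empty κ.snoc] at h
  have := congrArg Sigma.fst (skew_snoc_inj h).2
  simp at this

/-! ### Counting increasing subsequences -/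

/-- The number of increasing subsequences of length `k`. -/
def inc (k : ℕ) (π : AnyPerm) : ℕ :=
  Finset.card {s ∈ (Finset.range π.1).powersetCard k | ∀ x ∈ s, ∀ y ∈ s, x < y → π.ev x < π.ev y}

/-- An increasing occurrence is determined by its set of positions, and finite sets are easier to
split than order embeddings. -/
theorem numOccurrences_eq_inc (k : ℕ) (π : AnyPerm) :
    numOccurrences (increasingPattern k) π.2 = inc k π := by
  classical
  rw [numOccurrences, inc, ← Nat.card_eq_finsetCard]
  refine Nat.card_congr (Equiv.ofBijective (fun f => ⟨Finset.univ.map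
    (f.1.toEmbedding.trans Fin.valEmbedding), ?_⟩) ⟨?_, ?_⟩)
  · refine Finset.mem_filter.mpr ⟨Finset.mem_powersetCard.mpr ⟨?_, by simp⟩, ?_⟩
    · intro x hx
      obtain ⟨i, -, rfl⟩ := Finset.mem_map.mp hx
      exact Finset.mem_range.mpr (f.1 i).2
    · intro x hx y hy hxy
      obtain ⟨i, -, rfl⟩ := Finset.mem_map.mp hx
      obtain ⟨j, -, rfl⟩ := Finset.mem_map.mp hy
      have hij : i < j := f.1.lt_iff_lt.mp (Fin.lt_def.mpr hxy)
      have := (f.2 i j).mpr hij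
      simpa [ev_of_lt] using this
  · intro f g hfg
    have h := congrArg Subtype.val hfg
    simp only [← Finset.map_map] at h
    have h := Finset.map_injective _ h
    refine Subtype.ext (DFunLike.coe_injective ?_)
    refine (f.1.strictMono.range_inj g.1.strictMono).mp ?_
    simpa [← Finset.coe_inj] using h
  · rintro ⟨s, hs⟩
    obtain ⟨hs, h⟩ := Finset.mem_filter.mp hs
    obtain ⟨hs, hk⟩ := Finset.mem_powersetCard.mp hs
    have hlt : ∀ i, s.orderEmbOfFin hk i < π.1 := fun i =>
      Finset.mem_range.mp (hs (s.orderEmbOfFin_mem hk i))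
    let f : Fin k ↪o Fin π.1 := OrderEmbedding.ofStrictMono (fun i => ⟨_, hlt i⟩)
      fun i j hij => Fin.lt_def.mpr ((s.orderEmbOfFin hk).strictMono hij)
    have hf : StrictMono fun i => π.2 (f i) := fun i j hij => by
      have := h _ (s.orderEmbOfFin_mem hk i) _ (s.orderEmbOfFin_mem hk j)
        ((s.orderEmbOfFin hk).strictMono hij)
      rwa [ev_of_lt _ (hlt i), ev_of_lt _ (hlt j)] at this
    refine ⟨⟨f, fun i j => hf.lt_iff_lt⟩, Subtype.ext (Finset.coe_injective ?_)⟩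
    rw [← s.range_orderEmbOfFin hk]
    simp only [Finset.coe_map, Finset.coe_univ, Set.image_univ]
    rfl

theorem inc_zero (π : AnyPerm) : inc 0 π = 1 := by
  rw [inc, Finset.powersetCard_zero, Finset.filter_singleton, if_pos (by simp)]
  rfl

/-- Replacing positions by values turns an increasing subsequence of `π` into one of `π⁻¹`. -/
theorem inc_le_inc_inv (k : ℕ) (π : AnyPerm) : inc k π ≤ inc k π.inv := by
  refine Finset.card_le_card_of_injOn (Finset.image π.ev) (fun s hs => ?_)
    (Finset.image_injective π.ev_injective).injOn
  obtain ⟨hs, h⟩ := Finset.mem_filter.mp hs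
  obtain ⟨hs, hk⟩ := Finset.mem_powersetCard.mp hs
  refine Finset.mem_filter.mpr ⟨Finset.mem_powersetCard.mpr ⟨?_, ?_⟩, ?_⟩
  · intro x hx
    obtain ⟨y, hy, rfl⟩ := Finset.mem_image.mp hx
    exact Finset.mem_range.mpr (π.ev_lt (Finset.mem_range.mp (hs hy)))
  · rw [Finset.card_image_of_injective _ π.ev_injective, hk]
  · simp only [Finset.forall_mem_image, ev_inv_ev]
    intro x hx y hy hxy
    by_contra! hc
    rcases hc.lt_or_eq with hc | rfl
    · exact (h y hy x hx hc).not_gt hxy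
    · exact lt_irrefl _ hxy

theorem inc_inv (k : ℕ) (π : AnyPerm) : inc k π.inv = inc k π :=
  (inc_le_inc_inv k π.inv).antisymm (inc_le_inc_inv k π)

/-- The two terms count the subsequences that omit and that use the last letter. -/
theorem inc_snoc (k : ℕ) (σ : AnyPerm) : inc (k + 1) σ.snoc = inc (k + 1) σ + inc k σ := by
  have hn : ∀ {k s}, s ∈ (Finset.range σ.1).powersetCard k → σ.1 ∉ s := fun hs h =>
    absurd ((Finset.mem_powersetCard.mp hs).1 h) (by simp)
  rw [inc, snoc_fst, ev_snoc, Finset.range_add_one,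
    Finset.powersetCard_succ_insert Finset.notMem_range_self, Finset.filter_union,
    Finset.card_union_of_disjoint]
  · congr 1
    rw [Finset.filter_image, Finset.card_image_of_injOn]
    · rw [inc]
      congr 1
      refine Finset.filter_congr fun s hs => ?_
      have hlt : ∀ x ∈ s, x < σ.1 := fun x hx =>
        Finset.mem_range.mp ((Finset.mem_powersetCard.mp hs).1 hx)
      constructor
      · intro h x hx y hy
        exact h x (Finset.mem_insert_of_mem hx) y (Finset.mem_insert_of_mem hy)
      · intro h x hx y hy hxy
        rcases Finset.mem_insert.mp hx with rfl | hx <;>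
          rcases Finset.mem_insert.mp hy with rfl | hy
        · exact absurd hxy (lt_irrefl _)
        · exact absurd hxy (hlt y hy).not_gt
        · rw [σ.ev_of_le le_rfl]
          exact σ.ev_lt hxy
        · exact h x hx y hy hxy
    · intro s hs t ht hst
      have hs := hn (Finset.mem_filter.mp hs).1
      have ht := hn (Finset.mem_filter.mp ht).1
      rw [← Finset.erase_insert hs, ← Finset.erase_insert ht, hst]
  · rw [Finset.disjoint_left]
    intro s hs hs'
    obtain ⟨t, -, rfl⟩ := Finset.mem_image.mp (Finset.mem_filter.mp hs').1
    exact hn (Finset.mem_filter.mp hs).1 (Finset.mem_insert_self _ _)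

/-- Length `k + 1` excludes the empty subsequence, which would be counted in both blocks. -/
theorem inc_skew (k : ℕ) (π ρ : AnyPerm) :
    inc (k + 1) (skew π ρ) = inc (k + 1) π + inc (k + 1) ρ := by
  classical
  have hinj : Function.Injective (Finset.map (addLeftEmbedding π.1)) := Finset.map_injective _
  rw [inc, inc, show inc (k + 1) ρ = _ from (Finset.card_map ⟨_, hinj⟩).symm,
    ← Finset.card_union_of_disjoint]
  · congr 1
    ext s
    simp only [Finset.mem_union, Finset.mem_filter, Finset.mem_powersetCard, Finset.mem_map,
      Function.Embedding.coeFn_mk, skew_fst]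
    constructor
    · rintro ⟨⟨hs, hk⟩, h⟩
      by_cases hl : ∀ x ∈ s, x < π.1
      · refine Or.inl ⟨⟨fun x hx => Finset.mem_range.mpr (hl x hx), hk⟩, fun x hx y hy hxy => ?_⟩
        have := h x hx y hy hxy
        rw [ev_skew_left _ _ (hl x hx), ev_skew_left _ _ (hl y hy)] at this
        omega
      · push Not at hl
        obtain ⟨y, hy, hyπ⟩ := hl
        -- One position in the lower right block forces the rest there: a step from the left block
        -- to it would descend.
        have hr : ∀ x ∈ s, π.1 ≤ x := fun x hx => by
          by_contra! hc
          have h1 := h x hx y hy (by omega)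
          have h2 := Finset.mem_range.mp (hs hy)
          obtain ⟨z, rfl⟩ := Nat.exists_eq_add_of_le hyπ
          rw [ev_skew_left _ _ hc, ev_skew_right _ _ (by omega)] at h1
          have := ρ.ev_lt (i := z) (by omega)
          omega
        obtain ⟨t, rfl⟩ : ∃ t : Finset ℕ, t.map (addLeftEmbedding π.1) = s := by
          refine ⟨s.image (· - π.1), ?_⟩
          ext x
          simp only [Finset.mem_map, Finset.mem_image, addLeftEmbedding_apply,
            exists_exists_and_eq_and]
          constructor
          · rintro ⟨x, hx, rfl⟩
            rwa [Nat.add_sub_cancel' (hr x hx)]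
          · exact fun hx => ⟨x, hx, Nat.add_sub_cancel' (hr x hx)⟩
        have ht : ∀ x ∈ t, x < ρ.1 := fun x hx => by
          simpa using hs (Finset.mem_map_of_mem _ hx)
        refine Or.inr ⟨t, ⟨⟨fun x hx => Finset.mem_range.mpr (ht x hx), by simpa using hk⟩,
          fun x hx y hy hxy => ?_⟩, rfl⟩
        have := h _ (Finset.mem_map_of_mem _ hx) _ (Finset.mem_map_of_mem _ hy) (by simpa)
        simpa [ev_skew_right _ _ (ht x hx), ev_skew_right _ _ (ht y hy)] using this
    · rintro (⟨⟨hs, hk⟩, h⟩ | ⟨t, ⟨⟨ht, hk⟩, h⟩, rfl⟩)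
      · refine ⟨⟨hs.trans (Finset.range_subset_range.mpr (by omega)), hk⟩, fun x hx y hy hxy => ?_⟩
        rw [ev_skew_left _ _ (Finset.mem_range.mp (hs hx)),
          ev_skew_left _ _ (Finset.mem_range.mp (hs hy))]
        exact Nat.add_lt_add_right (h x hx y hy hxy) _
      · refine ⟨⟨fun x hx => ?_, by simpa using hk⟩, fun x hx y hy hxy => ?_⟩
        · obtain ⟨y, hy, rfl⟩ := Finset.mem_map.mp hx
          simpa using ht hy
        · obtain ⟨x, hx', rfl⟩ := Finset.mem_map.mp hx
          obtain ⟨y, hy', rfl⟩ := Finset.mem_map.mp hy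
          simp only [addLeftEmbedding_apply] at hxy ⊢
          rw [ev_skew_right _ _ (Finset.mem_range.mp (ht hx')),
            ev_skew_right _ _ (Finset.mem_range.mp (ht hy'))]
          exact h x hx' y hy' (by omega)
  · rw [Finset.disjoint_left]
    intro s hs hs'
    obtain ⟨t, ht, rfl⟩ := Finset.mem_map.mp hs'
    obtain ⟨hs, hk⟩ := Finset.mem_powersetCard.mp (Finset.mem_filter.mp hs).1
    obtain ⟨x, hx⟩ := Finset.card_pos.mp ((Nat.succ_pos k).trans_eq hk.symm)
    obtain ⟨y, hy, rfl⟩ := Finset.mem_map.mp hx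
    simpa using hs hx

end AnyPerm

/-! ### Exponent vectors of the building blocks -/

open AnyPerm

/-- The exponents of `∏ (x_k x_{k+1}) ^ d_k`. -/
noncomputable def shiftExponent : (ℕ+ →₀ ℕ) →+ (ℕ+ →₀ ℕ) :=
  AddMonoidHom.id _ + Finsupp.mapDomain.addMonoidHom (· + 1)

theorem shiftExponent_apply (d : ℕ+ →₀ ℕ) :
    shiftExponent d = d + Finsupp.mapDomain (· + 1) d := rfl

theorem shiftExponent_one (d : ℕ+ →₀ ℕ) : shiftExponent d 1 = d 1 := by
  rw [shiftExponent_apply, Finsupp.add_apply, Finsupp.mapDomain_of_notMem_range, add_zero]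
  rintro ⟨k, hk⟩
  exact absurd hk (PNat.lt_add_left 1 k).ne'

theorem shiftExponent_succ (d : ℕ+ →₀ ℕ) (k : ℕ+) :
    shiftExponent d (k + 1) = d (k + 1) + d k := by
  rw [shiftExponent_apply, Finsupp.add_apply, Finsupp.mapDomain_apply (add_left_injective 1)]

theorem le_shiftExponent (d : ℕ+ →₀ ℕ) : d ≤ shiftExponent d := le_self_add

theorem shiftExponent_single (k : ℕ+) : shiftExponent (Finsupp.single k 1) =
    Finsupp.single k 1 + Finsupp.single (k + 1) 1 := by
  rw [shiftExponent_apply, Finsupp.mapDomain_single]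

theorem patternExponent_apply (π : AnyPerm) (k : ℕ+) : patternExponent π k = inc k π :=
  numOccurrences_eq_inc k π

theorem patternExponent_empty : patternExponent AnyPerm.empty = 0 := by
  ext k
  exact numOccurrences_eq_zero_of_lt _ _ k.pos

theorem patternExponent_inv (π : AnyPerm) : patternExponent π.inv = patternExponent π := by
  ext k
  rw [patternExponent_apply, patternExponent_apply, inc_inv]

theorem patternExponent_skew (π ρ : AnyPerm) :
    patternExponent (skew π ρ) = patternExponent π + patternExponent ρ := by
  ext k
  rw [Finsupp.add_apply, patternExponent_apply, patternExponent_apply, patternExponent_apply,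
    ← PNat.natPred_add_one k, inc_skew]

/-- The isolated `x₁` is the empty subsequence of `σ` extended by the new letter; longer ones
account for the shift. -/
theorem patternExponent_snoc (σ : AnyPerm) :
    patternExponent σ.snoc = Finsupp.single 1 1 + shiftExponent (patternExponent σ) := by
  ext k
  rw [Finsupp.add_apply, patternExponent_apply]
  induction k using PNat.recOn with
  | one =>
    rw [shiftExponent_one, Finsupp.single_eq_same, patternExponent_apply, add_comm]
    exact (inc_snoc 0 σ).trans (by rw [inc_zero]; rfl)
  | succ k _ =>
    rw [shiftExponent_succ, Finsupp.single_eq_of_ne (PNat.lt_add_left 1 k).ne', zero_add,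
      patternExponent_apply, patternExponent_apply]
    exact inc_snoc k σ

theorem mem_perms132 {π : AnyPerm} : π ∈ perms132 ↔ Avoids132 π := avoids132_iff π

theorem mem_involutions132 {π : AnyPerm} :
    π ∈ involutions132 ↔ π.inv = π ∧ Avoids132 π := by
  refine and_congr ⟨fun h => ?_, fun h => ?_⟩ (avoids132_iff π)
  · exact congrArg (Sigma.mk π.1) h.symm
  · obtain ⟨n, π⟩ := π
    exact (eq_of_heq (Sigma.mk.inj h).2).symm

/-! ### The bijections and the functional equations -/

/-- A `1-3-2`-avoiding permutation is empty or a skew sum `(σ ⊕ 1) ⊖ τ`. -/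
noncomputable def perms132Equiv : Unit ⊕ (perms132 × perms132) ≃ perms132 :=
  Equiv.ofBijective
    (Sum.elim (fun _ => ⟨AnyPerm.empty, mem_perms132.mpr avoids132_empty⟩)
      fun p => ⟨skew p.1.1.snoc p.2.1, mem_perms132.mpr (avoids132_skew.mpr
        ⟨avoids132_snoc.mpr (mem_perms132.mp p.1.2), mem_perms132.mp p.2.2⟩)⟩) <| by
    constructor
    · rintro (_ | ⟨⟨σ, hσ⟩, ⟨τ, hτ⟩⟩) (_ | ⟨⟨σ', hσ'⟩, ⟨τ', hτ'⟩⟩) h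
      · rfl
      · have := congrArg (fun π => π.1.1) h
        simp at this
        omega
      · have := congrArg (fun π => π.1.1) h
        simp at this
      · obtain ⟨rfl, rfl⟩ := skew_snoc_inj (congrArg Subtype.val h)
        rfl
    · rintro ⟨π, hπ⟩
      rcases Nat.eq_zero_or_pos π.1 with h | h
      · exact ⟨Sum.inl (), Subtype.ext (eq_empty h).symm⟩
      · obtain ⟨σ, τ, hσ, hτ, h⟩ := (mem_perms132.mp hπ).exists_eq_skew h
        exact ⟨Sum.inr (⟨σ, mem_perms132.mpr hσ⟩, ⟨τ, mem_perms132.mpr hτ⟩), Subtype.ext h.symm⟩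

/-- A `1-3-2`-avoiding involution is empty, or `ρ ⊕ 1` or `(σ ⊕ 1) ⊖ ρ ⊖ (σ⁻¹ ⊕ 1)` for some
`1-3-2`-avoiding involution `ρ`. -/
noncomputable def involutions132Equiv :
    Unit ⊕ (involutions132 ⊕ (perms132 × involutions132)) ≃ involutions132 :=
  Equiv.ofBijective
    (Sum.elim (fun _ => ⟨AnyPerm.empty, mem_involutions132.mpr ⟨eq_empty rfl, avoids132_empty⟩⟩) <|
      Sum.elim (fun ρ => ⟨ρ.1.snoc, mem_involutions132.mpr (by
          have := mem_involutions132.mp ρ.2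
          rw [inv_snoc, this.1, avoids132_snoc]
          exact ⟨rfl, this.2⟩)⟩)
        fun p => ⟨skew p.1.1.snoc (skew p.2.1 p.1.1.inv.snoc), mem_involutions132.mpr (by
          have h1 := mem_perms132.mp p.1.2
          have h2 := mem_involutions132.mp p.2.2
          rw [inv_skew, inv_skew, inv_snoc, inv_snoc, inv_inv, h2.1, skew_assoc, avoids132_skew,
            avoids132_skew, avoids132_snoc, avoids132_snoc]
          exact ⟨rfl, h1, h2.2, h1.inv⟩)⟩) <| by
    constructor
    · rintro (_ | ⟨ρ, hρ⟩ | ⟨⟨σ, hσ⟩, ⟨ρ, hρ⟩⟩) (_ | ⟨ρ', hρ'⟩ | ⟨⟨σ', hσ'⟩, ⟨ρ', hρ'⟩⟩) h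
      · rfl
      · have := congrArg (fun π => π.1.1) h
        simp at this
      · have := congrArg (fun π => π.1.1) h
        simp at this
      · have := congrArg (fun π => π.1.1) h
        simp at this
      · obtain rfl := snoc_injective (congrArg Subtype.val h)
        rfl
      · exact absurd (congrArg Subtype.val h) snoc_ne_skew_snoc_skew
      · have := congrArg (fun π => π.1.1) h
        simp at this
      · exact absurd (congrArg Subtype.val h).symm snoc_ne_skew_snoc_skew
      · obtain ⟨rfl, rfl⟩ := skew_snoc_skew_inj (congrArg Subtype.val h)
        rfl
    · rintro ⟨π, hπ⟩
      have hπ' := mem_involutions132.mp hπ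
      rcases Nat.eq_zero_or_pos π.1 with h | h
      · exact ⟨Sum.inl (), Subtype.ext (eq_empty h).symm⟩
      · rcases exists_eq_skew_of_inv_eq hπ'.2 hπ'.1 h with
          ⟨ρ, h1, h2, h⟩ | ⟨σ, ρ, h1, h2, h3, h⟩
        · exact ⟨Sum.inr (Sum.inl ⟨ρ, mem_involutions132.mpr ⟨h2, h1⟩⟩), Subtype.ext h.symm⟩
        · exact ⟨Sum.inr (Sum.inr (⟨σ, mem_perms132.mpr h1⟩,
            ⟨ρ, mem_involutions132.mpr ⟨h3, h2⟩⟩)), Subtype.ext h.symm⟩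

theorem finite_fiber_unit (e d : ℕ+ →₀ ℕ) : Finite {_t : Unit // e = d} := inferInstance

theorem finite_fiber_sum {T T' : Type} {w : T → ℕ+ →₀ ℕ} {w' : T' → ℕ+ →₀ ℕ}
    (hw : ∀ d, Finite {t // w t = d}) (hw' : ∀ d, Finite {t // w' t = d}) (d : ℕ+ →₀ ℕ) :
    Finite {t // Sum.elim w w' t = d} := by
  have : Finite {t // Sum.elim w w' (Sum.inl t) = d} := hw d
  have : Finite {t // Sum.elim w w' (Sum.inr t) = d} := hw' d
  exact Finite.of_equiv _ (Equiv.subtypeSum (p := fun t => Sum.elim w w' t = d)).symm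

theorem weightGF_const_add {T : Type} {w : T → ℕ+ →₀ ℕ} (hw : ∀ d, Finite {t // w t = d})
    (e : ℕ+ →₀ ℕ) : weightGF (fun t => e + w t) = monomial e 1 * weightGF w := by
  rw [← weightGF_unit, ← weightGF_prod (fun d => finite_fiber_unit e d) hw]
  exact weightGF_congr (Equiv.punitProd T).symm fun t => rfl

theorem X_mul_X_eq (k : ℕ+) : (X k * X (k + 1) : MvPowerSeries ℕ+ ℤ) =
    monomial (shiftExponent (Finsupp.single k 1)) 1 := by
  rw [shiftExponent_single, X, X, monomial_mul_monomial, one_mul]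

theorem X_sq_mul_X_sq_eq (k : ℕ+) : (X k ^ 2 * X (k + 1) ^ 2 : MvPowerSeries ℕ+ ℤ) =
    monomial ((shiftExponent + shiftExponent) (Finsupp.single k 1)) 1 := by
  rw [← mul_pow, X_mul_X_eq, sq, monomial_mul_monomial, one_mul]
  rfl

theorem subst_shift_patternGF (A : Set AnyPerm) :
    subst (fun k : ℕ+ => (X k * X (k + 1) : MvPowerSeries ℕ+ ℤ)) (patternGF A) =
      weightGF (fun π : A => shiftExponent (patternExponent π)) := by
  rw [patternGF_eq_weightGF, weightGF_subst (finite_patternExponent_fiber A) hasSubst_shift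
    shiftExponent le_shiftExponent X_mul_X_eq]

theorem subst_shift_sq_patternGF (A : Set AnyPerm) :
    subst (fun k : ℕ+ => (X k ^ 2 * X (k + 1) ^ 2 : MvPowerSeries ℕ+ ℤ)) (patternGF A) =
      weightGF (fun π : A => (shiftExponent + shiftExponent) (patternExponent π)) := by
  rw [patternGF_eq_weightGF, weightGF_subst (finite_patternExponent_fiber A) hasSubst_shift_sq
    (shiftExponent + shiftExponent) (fun d => (le_shiftExponent d).trans le_self_add)
    X_sq_mul_X_sq_eq]

theorem CS_eq : CS = 1 + X 1 * subst (fun k : ℕ+ => X k * X (k + 1)) CS * CS := by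
  have f1 := finite_patternExponent_fiber perms132
  have f2 := finite_fiber_of_le f1 (w' := fun π => shiftExponent (patternExponent π))
    fun π => le_shiftExponent _
  have f3 := finite_fiber_of_le f2
    (w' := fun π => Finsupp.single 1 1 + shiftExponent (patternExponent π)) fun π => le_add_self
  have h := weightGF_congr (w := Sum.elim (fun _ => 0) fun p : perms132 × perms132 =>
      (Finsupp.single 1 1 + shiftExponent (patternExponent p.1)) + patternExponent p.2)
    (w' := fun π : perms132 => patternExponent π) perms132Equiv (by
      rintro (_ | p)
      · exact patternExponent_empty
      · exact (patternExponent_skew _ _).trans (by rw [patternExponent_snoc]; rfl))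
  rw [weightGF_sum (fun d => finite_fiber_unit 0 d) (finite_fiber_prod f3 f1), weightGF_unit,
    monomial_zero_one, weightGF_prod f3 f1, weightGF_const_add f2] at h
  rw [CS, subst_shift_patternGF, patternGF_eq_weightGF]
  exact h.symm

/-- The blocks `σ ⊕ 1` and `σ⁻¹ ⊕ 1` carry the same weight, hence the exponent `2` on `X 1` and the
doubled shift, with `σ` ranging over all avoiders. -/
theorem CI_eq : CI = 1 + X 1 * subst (fun k : ℕ+ => X k * X (k + 1)) CI +
    X 1 ^ 2 * subst (fun k : ℕ+ => X k ^ 2 * X (k + 1) ^ 2) CS * CI := by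
  have f1 := finite_patternExponent_fiber involutions132
  have f2 := finite_fiber_of_le f1 (w' := fun π => shiftExponent (patternExponent π))
    fun π => le_shiftExponent _
  have f3 := finite_fiber_of_le f2
    (w' := fun π => Finsupp.single 1 1 + shiftExponent (patternExponent π)) fun π => le_add_self
  have g1 := finite_patternExponent_fiber perms132
  have g2 := finite_fiber_of_le g1
    (w' := fun π => (shiftExponent + shiftExponent) (patternExponent π))
    fun π => (le_shiftExponent _).trans le_self_add
  have g3 := finite_fiber_of_le g2
    (w' := fun π => Finsupp.single 1 2 + (shiftExponent + shiftExponent) (patternExponent π))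
    fun π => le_add_self
  have h := weightGF_congr (w := Sum.elim (fun _ => 0) <| Sum.elim
      (fun ρ : involutions132 => Finsupp.single 1 1 + shiftExponent (patternExponent ρ))
      fun p : perms132 × involutions132 =>
        (Finsupp.single 1 2 + (shiftExponent + shiftExponent) (patternExponent p.1)) +
          patternExponent p.2)
    (w' := fun π : involutions132 => patternExponent π) involutions132Equiv (by
      rintro (_ | ρ | p)
      · exact patternExponent_empty
      · exact patternExponent_snoc _
      · refine (patternExponent_skew _ _).trans ?_
        rw [patternExponent_skew, patternExponent_snoc, patternExponent_snoc, patternExponent_inv,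
          Sum.elim_inr, Sum.elim_inr, AddMonoidHom.add_apply,
          show Finsupp.single (1 : ℕ+) 2 = Finsupp.single 1 1 + Finsupp.single 1 1 from
            Finsupp.single_add 1 1 1]
        abel)
  rw [weightGF_sum (fun d => finite_fiber_unit 0 d)
      (finite_fiber_sum f3 (finite_fiber_prod g3 f1)),
    weightGF_sum f3 (finite_fiber_prod g3 f1), weightGF_unit, monomial_zero_one,
    weightGF_prod g3 f1, weightGF_const_add f2, weightGF_const_add g2, ← add_assoc] at h
  rw [CS, CI, subst_shift_patternGF, subst_shift_sq_patternGF, patternGF_eq_weightGF, X_pow_eq]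
  exact h.symm

/-- `Ring.inverse` is `0` at a non-unit, so the `IsUnit` conjuncts make the quotients genuine. -/
theorem mainTheorem11 :
    (IsUnit (1 - X 1 ^ 2 * subst (fun k : ℕ+ => X k ^ 2 * X (k + 1) ^ 2) CS :
        MvPowerSeries ℕ+ ℤ) ∧
      CI = (1 + X 1 * subst (fun k : ℕ+ => X k * X (k + 1)) CI) *
        Ring.inverse (1 - X 1 ^ 2 * subst (fun k : ℕ+ => X k ^ 2 * X (k + 1) ^ 2) CS)) ∧
    (IsUnit (1 - X 1 * subst (fun k : ℕ+ => X k * X (k + 1)) CS : MvPowerSeries ℕ+ ℤ) ∧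
      CS = Ring.inverse (1 - X 1 * subst (fun k : ℕ+ => X k * X (k + 1)) CS)) := by
  have hI : IsUnit (1 - X 1 ^ 2 * subst (fun k : ℕ+ => X k ^ 2 * X (k + 1) ^ 2) CS :
      MvPowerSeries ℕ+ ℤ) := by
    -- The factor `X 1 ^ 2` kills the constant term of the product, leaving constant coefficient
    -- `1`.
    rw [isUnit_iff_constantCoeff]
    simp
  have hS : IsUnit (1 - X 1 * subst (fun k : ℕ+ => X k * X (k + 1)) CS :
      MvPowerSeries ℕ+ ℤ) := by
    rw [isUnit_iff_constantCoeff]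
    simp
  refine ⟨⟨hI, ?_⟩, hS, ?_⟩
  · rw [Ring.eq_mul_inverse_iff_mul_eq _ _ _ hI]
    linear_combination CI_eq
  · rw [← one_mul (Ring.inverse _), Ring.eq_mul_inverse_iff_mul_eq _ _ _ hS]
    linear_combination CS_eq
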